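/- For each $n\ge1$ let $(z_1,\dots,z_n)=(z_{n,1},\dots,z_{n,n})$ be a random vector in $\mathbb{C}^n$ (the vectors for different $n$ may live on different probability spaces) whose joint density with respect to Lebesgue measure on $\mathbb{C}^n$ is $$C_n\prod_{1\le j<k\le n}|z_j-z_k|^2\prod_{k=1}^n\frac{1}{(1+|z_k|^2)^{n+1}},$$ where $C_n>0$ is the normalizing constant. For $k\ge1$ and $y>0$ put $$H_k(y)=e^{-y}\sum_{j=0}^{k-1}\frac{y^j}{j!},$$ that is, the probability that a Poisson random variable with parameter $y$ is at most $k-1$. Then the infinite product $\prod_{k\ge1}H_k(x^{-2})$ converges for every $x>0$; the function $H$ given by $H(x)=\prod_{k=1}^\infty H_k(x^{-2})$ for $x>0$ and $H(x)=0$ for $x\le0$ is the cumulative distribution function of a probability measure on $\mathbb{R}$; and, as $n\to\infty$, $\frac{1}{\sqrt n}\max_{1\le j\le n}|z_{n,j}|$ converges weakly (in distribution) to this probability measure. -/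

import Mathlib

open MeasureTheory ProbabilityTheory Filter

/-- The unnormalized joint density of the eigenvalues of the spherical ensemble,
`∏_{j<k} |w_j - w_k|² · ∏_k (1 + |w_k|²)^{-(n+1)}`. -/
noncomputable def sphericalWeight (n : ℕ) (w : Fin n → ℂ) : ℝ :=
  (∏ j : Fin n, ∏ k ∈ Finset.Ioi j, ‖w j - w k‖ ^ 2) *
    ∏ k : Fin n, 1 / (1 + ‖w k‖ ^ 2) ^ (n + 1)

/-- The random vector `(z_1, …, z_n)` has joint density `C · sphericalWeight n` with respect to
Lebesgue measure on `ℂⁿ`, for some constant `C` (necessarily the normalizing one, since `P` is a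
probability measure wherever this is used). -/
def HasSphericalDensity {Ω : Type*} [MeasurableSpace Ω] (P : Measure Ω) (n : ℕ)
    (z : Fin n → Ω → ℂ) : Prop :=
  ∃ C : ℝ, 0 < C ∧ HasLaw (fun ω j ↦ z j ω)
    ((volume : Measure (Fin n → ℂ)).withDensity
      (fun w ↦ ENNReal.ofReal (C * sphericalWeight n w))) P

/-- `H_k(y) = e^{-y} ∑_{j=0}^{k-1} y^j / j!`, the probability that a Poisson variable of
parameter `y` is at most `k - 1` (used for `k ≥ 1`). -/
noncomputable def poissonH (k : ℕ) (y : ℝ) : ℝ :=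
  Real.exp (-y) * ∑ j ∈ Finset.range k, y ^ j / (j.factorial : ℝ)

/-- `H(x) = ∏_{k ≥ 1} H_k(x⁻²)` for `x > 0`, and `H(x) = 0` for `x ≤ 0`. The product is indexed
by `i = k - 1`. -/
noncomputable def sphericalH (x : ℝ) : ℝ :=
  if 0 < x then ∏' i : ℕ, poissonH (i + 1) (x ^ 2)⁻¹ else 0

/-! The squared Vandermonde times a radial weight integrates over a polydisc of radius `R` as a
product: after expanding both determinants, monomials `w ^ a * conj w ^ b` with `a ≠ b` integrate to
zero on a disc, so only one-dimensional radial integrals remain (`integral_prod_norm_sub_sq`). Each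
has a binomial distribution function at `q = (1 + R ^ 2)⁻¹` as antiderivative, and letting `R → ∞`
fixes the constant, so `P (max ≤ R)` is exactly `∏ m < n, binomCDF n m q`.

With `R = x * √n` one has `n * q → x⁻²`, so each factor tends to a Poisson distribution function.
The bound `1 - binomCDF n m q ≤ (n * q) ^ (m + 1) / (m + 1)!` is summable in `m`, uniformly in large
`n`, so the product passes to the limit by dominated convergence. The same estimates show that `H`
is a distribution function. -/

open scoped Topology ComplexConjugate

/-! ### Binomial distribution functions -/

/-- The probability that a binomial variable with parameters `n` and `q` is at most `m`. -/
noncomputable def binomCDF (n m : ℕ) (q : ℝ) : ℝ :=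
  ∑ j ∈ Finset.range (m + 1), n.choose j * q ^ j * (1 - q) ^ (n - j)

/-- The derivatives of consecutive terms telescope, because `(m + 1) * n.choose (m + 1) = (n - m) *
n.choose m`. -/
lemma hasDerivAt_binomCDF (n m : ℕ) (q : ℝ) :
    HasDerivAt (binomCDF n m)
      (-(n.choose m * (n - m : ℕ) * q ^ m * (1 - q) ^ (n - m - 1))) q := by
  have h1 : HasDerivAt (fun q : ℝ ↦ 1 - q) (-1) q := by
    simpa using (hasDerivAt_id q).const_sub 1
  induction m with
  | zero =>
    have h := h1.fun_pow n
    have e : binomCDF n 0 = fun q ↦ (1 - q) ^ n := by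
      ext q; simp [binomCDF]
    rw [e]
    refine h.congr_deriv ?_
    simp
  | succ m ih =>
    have e : binomCDF n (m + 1) = fun q ↦ binomCDF n m q +
        n.choose (m + 1) * q ^ (m + 1) * (1 - q) ^ (n - (m + 1)) := by
      ext q; rw [binomCDF, Finset.sum_range_succ]; rfl
    rw [e]
    have h2 := ((hasDerivAt_pow (m + 1) q).const_mul (n.choose (m + 1) : ℝ)).mul
      (h1.fun_pow (n - (m + 1)))
    refine (ih.add h2).congr_deriv ?_
    have hc : (n.choose (m + 1) : ℝ) * (m + 1) = n.choose m * (n - m : ℕ) := by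
      exact_mod_cast Nat.choose_succ_right_eq n m
    rw [← hc, Nat.sub_sub]
    push_cast
    ring

lemma continuous_binomCDF (n m : ℕ) : Continuous (binomCDF n m) :=
  continuous_iff_continuousAt.2 fun q ↦ (hasDerivAt_binomCDF n m q).continuousAt

lemma binomCDF_zero (n m : ℕ) : binomCDF n m 0 = 1 := by
  simp [binomCDF, Finset.sum_range_succ']

lemma binomCDF_one {n m : ℕ} (h : m < n) : binomCDF n m 1 = 0 := by
  refine Finset.sum_eq_zero fun j hj ↦ ?_
  have : n - j ≠ 0 := by have := Finset.mem_range.1 hj; omega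
  simp [this]

lemma binomCDF_of_le {n m : ℕ} (h : n ≤ m) (q : ℝ) : binomCDF n m q = 1 := by
  have h1 := add_pow q (1 - q) n
  rw [add_sub_cancel, one_pow] at h1
  rw [h1, binomCDF]
  refine (Finset.sum_subset (Finset.range_mono (by omega)) fun j _ hj ↦ ?_).symm.trans
    (Finset.sum_congr rfl fun j _ ↦ by ring)
  rw [Nat.choose_eq_zero_of_lt (by simpa using hj)]
  simp

lemma binomCDF_nonneg (n m : ℕ) {q : ℝ} (h0 : 0 ≤ q) (h1 : q ≤ 1) : 0 ≤ binomCDF n m q := by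
  have := sub_nonneg.2 h1
  exact Finset.sum_nonneg fun j _ ↦ by positivity

lemma binomCDF_le_one (n m : ℕ) {q : ℝ} (h0 : 0 ≤ q) (h1 : q ≤ 1) : binomCDF n m q ≤ 1 := by
  have := sub_nonneg.2 h1
  rw [← binomCDF_of_le (le_max_left n m) q]
  exact Finset.sum_le_sum_of_subset_of_nonneg (Finset.range_mono (by omega))
    fun j _ _ ↦ by positivity

/-- Adding `n.choose (m + 1) * q ^ (m + 1)` outweighs the negative derivative of `binomCDF n m`, so
the sum is at least its value `1` at `q = 0`. -/
lemma one_sub_binomCDF_le (n m : ℕ) {q : ℝ} (h0 : 0 ≤ q) (h1 : q ≤ 1) :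
    1 - binomCDF n m q ≤ (n * q) ^ (m + 1) / (m + 1).factorial := by
  have hd (x : ℝ) := (hasDerivAt_binomCDF n m x).add
    ((hasDerivAt_pow (m + 1) x).const_mul (n.choose (m + 1) : ℝ))
  have hmono : MonotoneOn
      (binomCDF n m + fun x ↦ (n.choose (m + 1) : ℝ) * x ^ (m + 1)) (Set.Icc 0 1) := by
    refine monotoneOn_of_hasDerivWithinAt_nonneg (convex_Icc 0 1)
      (fun x _ ↦ (hd x).continuousAt.continuousWithinAt)
      (fun x _ ↦ (hd x).hasDerivWithinAt) fun x hx ↦ ?_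
    rw [interior_Icc] at hx
    have hc : (n.choose (m + 1) : ℝ) * (m + 1) = n.choose m * (n - m : ℕ) := by
      exact_mod_cast Nat.choose_succ_right_eq n m
    have hp : (1 - x) ^ (n - m - 1) ≤ 1 :=
      pow_le_one₀ (by linarith [hx.2]) (by linarith [hx.1])
    have hx0 := hx.1.le
    rw [← hc]
    have : 0 ≤ (n.choose (m + 1) : ℝ) * (m + 1) * x ^ m * (1 - (1 - x) ^ (n - m - 1)) :=
      mul_nonneg (by positivity) (by linarith)
    push_cast
    linarith
  have h := hmono ⟨le_rfl, zero_le_one⟩ ⟨h0, h1⟩ h0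
  simp only [Pi.add_apply, binomCDF_zero] at h
  have hb := Nat.choose_le_pow_div (α := ℝ) (m + 1) n
  have : (n.choose (m + 1) : ℝ) * q ^ (m + 1) ≤ (n * q) ^ (m + 1) / (m + 1).factorial := by
    rw [mul_pow, mul_div_right_comm]
    exact mul_le_mul_of_nonneg_right hb (by positivity)
  have h' : (0 : ℝ) ^ (m + 1) = 0 := zero_pow (by omega)
  rw [h'] at h
  linarith

/-! ### Poisson limit and infinite products -/

lemma tendsto_binomCDF_poissonH (m : ℕ) {p : ℕ → ℝ} {y : ℝ}
    (h : Tendsto (fun n ↦ n * p n) atTop (𝓝 y)) :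
    Tendsto (fun n ↦ binomCDF n m (p n)) atTop (𝓝 (poissonH (m + 1) y)) := by
  rw [poissonH, Finset.mul_sum]
  refine tendsto_finsetSum _ fun j _ ↦ ?_
  rw [← mul_div_assoc]
  exact tendsto_choose_mul_pow_of_tendsto_mul_atTop j h

lemma tendsto_nat_mul_div_add (y : ℝ) :
    Tendsto (fun n : ℕ ↦ (n : ℝ) * (y / (n + y))) atTop (𝓝 y) := by
  have h1 : Tendsto (fun n : ℕ ↦ y / ((n : ℝ) + y)) atTop (𝓝 0) :=
    (tendsto_atTop_add_const_right _ _ tendsto_natCast_atTop_atTop).const_div_atTop y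
  have h2 : Tendsto (fun n : ℕ ↦ y - y * (y / ((n : ℝ) + y))) atTop (𝓝 y) := by
    simpa using (h1.const_mul y).const_sub y
  have h3 : ∀ᶠ n : ℕ in atTop, (n : ℝ) + y ≠ 0 :=
    (tendsto_atTop_add_const_right _ _ tendsto_natCast_atTop_atTop).eventually_ne_atTop 0
  refine h2.congr' ?_
  filter_upwards [h3] with n hn
  field_simp
  ring

lemma poissonH_nonneg (k : ℕ) {y : ℝ} (hy : 0 ≤ y) : 0 ≤ poissonH k y := by
  unfold poissonH; positivity

/-- The binomial tail bound passes to the Poisson limit. The choice `y / (n + y)` lies in `[0, 1]`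
for every `n`, unlike `y / n`. -/
lemma abs_poissonH_sub_one_le (m : ℕ) {y : ℝ} (hy : 0 ≤ y) :
    |poissonH (m + 1) y - 1| ≤ y ^ (m + 1) / (m + 1).factorial := by
  have h := tendsto_binomCDF_poissonH m (tendsto_nat_mul_div_add y)
  have hr := ((tendsto_nat_mul_div_add y).pow (m + 1)).div_const ((m + 1).factorial : ℝ)
  have hq (n : ℕ) : 0 ≤ y / (n + y) ∧ y / (n + y) ≤ 1 :=
    ⟨by positivity, div_le_one_of_le₀ (by simp) (by positivity)⟩
  refine le_of_tendsto_of_tendsto' (h.sub_const 1).abs hr fun n ↦ ?_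
  rw [abs_sub_comm, abs_of_nonneg (by linarith [binomCDF_le_one n m (hq n).1 (hq n).2])]
  exact one_sub_binomCDF_le n m (hq n).1 (hq n).2

lemma poissonH_le_one (m : ℕ) {y : ℝ} (hy : 0 ≤ y) : poissonH m y ≤ 1 := by
  have h := Real.sum_le_exp_of_nonneg hy m
  rw [poissonH, Real.exp_neg, inv_mul_le_one₀ (Real.exp_pos y)]
  exact h

lemma continuous_poissonH (k : ℕ) : Continuous (poissonH k) := by
  unfold poissonH; fun_prop

lemma summable_pow_succ_div_factorial (y : ℝ) :
    Summable fun i : ℕ ↦ y ^ (i + 1) / (i + 1).factorial :=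
  (summable_nat_add_iff 1).2 (Real.summable_pow_div_factorial y)

lemma multipliable_poissonH {y : ℝ} (hy : 0 ≤ y) :
    Multipliable fun i : ℕ ↦ poissonH (i + 1) y := by
  have h : Summable fun i : ℕ ↦ poissonH (i + 1) y - 1 :=
    (summable_pow_succ_div_factorial y).of_norm_bounded fun i ↦ abs_poissonH_sub_one_le i hy
  simpa using Real.multipliable_one_add_of_summable h

/-- Dominated convergence for infinite products near the Poisson distribution functions. -/
lemma tendsto_tprod_poissonH {α : Type*} {l : Filter α} {a : α → ℕ → ℝ} {y Y : ℝ}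
    (hlim : ∀ i, Tendsto (fun n ↦ a n i) l (𝓝 (poissonH (i + 1) y)))
    (hbd : ∀ᶠ n in l, ∀ i, |a n i - 1| ≤ Y ^ (i + 1) / (i + 1).factorial) :
    Tendsto (fun n ↦ ∏' i, a n i) l (𝓝 (∏' i, poissonH (i + 1) y)) := by
  have := tendsto_tprod_one_add_of_dominated_convergence (summable_pow_succ_div_factorial Y)
    (f := fun n i ↦ a n i - 1) (g := fun i ↦ poissonH (i + 1) y - 1)
    (fun i ↦ (hlim i).sub_const 1) hbd
  simpa using this

lemma continuousWithinAt_tprod_poissonH (y : ℝ) :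
    ContinuousWithinAt (fun y ↦ ∏' i : ℕ, poissonH (i + 1) y) (Set.Ici 0) y := by
  refine tendsto_tprod_poissonH (Y := y + 1)
    (fun i ↦ (continuous_poissonH _).continuousAt.continuousWithinAt) ?_
  filter_upwards [self_mem_nhdsWithin, mem_nhdsWithin_of_mem_nhds (Iio_mem_nhds (lt_add_one y))]
    with z hz hzy i
  refine (abs_poissonH_sub_one_le i hz).trans ?_
  have hz : 0 ≤ z := hz
  have hzy : z ≤ y + 1 := le_of_lt hzy
  gcongr

lemma tendsto_prod_binomCDF {y : ℝ} {p : ℕ → ℝ} (hp0 : ∀ n, 0 ≤ p n) (hp1 : ∀ n, p n ≤ 1)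
    (hp : Tendsto (fun n ↦ n * p n) atTop (𝓝 y)) :
    Tendsto (fun n ↦ ∏ m ∈ Finset.range n, binomCDF n m (p n)) atTop
      (𝓝 (∏' i : ℕ, poissonH (i + 1) y)) := by
  have h : Tendsto (fun n ↦ ∏' m, binomCDF n m (p n)) atTop
      (𝓝 (∏' i : ℕ, poissonH (i + 1) y)) := by
    refine tendsto_tprod_poissonH (Y := y + 1) (fun i ↦ tendsto_binomCDF_poissonH i hp) ?_
    filter_upwards [hp.eventually (Iio_mem_nhds (lt_add_one y))] with n hn i
    rw [abs_sub_comm, abs_of_nonneg (by linarith [binomCDF_le_one n i (hp0 n) (hp1 n)])]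
    refine (one_sub_binomCDF_le n i (hp0 n) (hp1 n)).trans ?_
    have := hp0 n
    have hn : (n : ℝ) * p n ≤ y + 1 := le_of_lt hn
    gcongr
  -- Factors with `m ≥ n` equal `1`, so the infinite product is the finite one.
  refine h.congr fun n ↦ tprod_eq_prod fun m hm ↦ binomCDF_of_le (by simpa using hm) _

/-! ### The limiting distribution function -/

/-- `H` is the limit of the finite products of binomial distribution functions. -/
lemma tendsto_prod_binomCDF_sphericalH {x : ℝ} (hx : 0 < x) :
    Tendsto (fun n : ℕ ↦ ∏ m ∈ Finset.range n, binomCDF n m (1 + (x * √n) ^ 2)⁻¹) atTop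
      (𝓝 (sphericalH x)) := by
  rw [sphericalH, if_pos hx]
  refine tendsto_prod_binomCDF (fun n ↦ by positivity)
    (fun n ↦ inv_le_one_of_one_le₀ (by nlinarith [sq_nonneg (x * √n)])) ?_
  refine (tendsto_nat_mul_div_add (x ^ 2)⁻¹).congr fun n ↦ ?_
  rw [mul_pow, Real.sq_sqrt (by positivity)]
  field_simp
  ring

/-- All factors are at most `1`, and the first is this exponential. This gives right continuity of
`H` at `0`. -/
lemma sphericalH_le_exp {x : ℝ} (hx : 0 < x) : sphericalH x ≤ Real.exp (-(x ^ 2)⁻¹) := by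
  have hy : (0 : ℝ) ≤ (x ^ 2)⁻¹ := by positivity
  rw [sphericalH, if_pos hx]
  have h := (multipliable_poissonH hy).hasProd.tendsto_prod_nat
  refine le_of_tendsto h ?_
  filter_upwards [eventually_ge_atTop 1] with n hn
  obtain ⟨n, rfl⟩ := Nat.exists_eq_add_of_le' hn
  rw [Finset.prod_range_succ']
  have h1 : ∏ k ∈ Finset.range n, poissonH (k + 1 + 1) (x ^ 2)⁻¹ ≤ 1 :=
    Finset.prod_le_one (fun i _ ↦ poissonH_nonneg _ hy) fun i _ ↦ poissonH_le_one _ hy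
  have h2 : poissonH (0 + 1) (x ^ 2)⁻¹ = Real.exp (-(x ^ 2)⁻¹) := by simp [poissonH]
  rw [h2]
  exact mul_le_of_le_one_left (Real.exp_pos _).le h1

lemma sphericalH_nonneg (x : ℝ) : 0 ≤ sphericalH x := by
  rcases le_or_gt x 0 with hx | hx
  · simp [sphericalH, hx.not_gt]
  · rw [sphericalH, if_pos hx]
    exact ge_of_tendsto' (multipliable_poissonH (by positivity)).hasProd.tendsto_prod_nat
      fun n ↦ Finset.prod_nonneg fun i _ ↦ poissonH_nonneg _ (by positivity)

lemma tendsto_sphericalH_nhdsGT_zero : Tendsto sphericalH (𝓝[>] 0) (𝓝 0) := by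
  have h : Tendsto (fun x : ℝ ↦ Real.exp (-(x ^ 2)⁻¹)) (𝓝[>] 0) (𝓝 0) := by
    refine Real.tendsto_exp_neg_atTop_nhds_zero.comp (tendsto_inv_nhdsGT_zero.comp ?_)
    refine tendsto_nhdsWithin_iff.2 ⟨?_, ?_⟩
    · have : Tendsto (fun x : ℝ ↦ x ^ 2) (𝓝 0) (𝓝 (0 ^ 2)) := (continuous_pow 2).continuousAt
      simpa using this.mono_left nhdsWithin_le_nhds
    · filter_upwards [self_mem_nhdsWithin] with x (hx : 0 < x)
      exact pow_pos hx 2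
  refine tendsto_of_tendsto_of_tendsto_of_le_of_le' tendsto_const_nhds h
    (Eventually.of_forall sphericalH_nonneg) ?_
  filter_upwards [self_mem_nhdsWithin] with x hx using sphericalH_le_exp hx

lemma tendsto_sphericalH_atTop : Tendsto sphericalH atTop (𝓝 1) := by
  have h := continuousWithinAt_tprod_poissonH 0
  have h0 : ∏' i : ℕ, poissonH (i + 1) 0 = 1 := by
    simp [poissonH, Finset.sum_range_succ']
  rw [ContinuousWithinAt, h0] at h
  have ht : Tendsto (fun x : ℝ ↦ (x ^ 2)⁻¹) atTop (𝓝[Set.Ici 0] 0) :=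
    tendsto_nhdsWithin_iff.2 ⟨tendsto_inv_atTop_zero.comp (tendsto_pow_atTop two_ne_zero),
      Eventually.of_forall fun x ↦ by simp only [Set.mem_Ici]; positivity⟩
  refine (h.comp ht).congr' ?_
  filter_upwards [eventually_gt_atTop 0] with x hx
  simp [sphericalH, hx]

lemma continuousAt_sphericalH {x : ℝ} (hx : 0 < x) : ContinuousAt sphericalH x := by
  have h := continuousWithinAt_tprod_poissonH (x ^ 2)⁻¹
  have ht : Tendsto (fun x : ℝ ↦ (x ^ 2)⁻¹) (𝓝 x) (𝓝[Set.Ici 0] (x ^ 2)⁻¹) :=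
    tendsto_nhdsWithin_iff.2
      ⟨((continuous_pow 2).continuousAt.inv₀ (by positivity)),
        Eventually.of_forall fun x ↦ by simp only [Set.mem_Ici]; positivity⟩
  rw [ContinuousAt]
  have h' := h.tendsto.comp ht
  rw [show sphericalH x = ∏' i : ℕ, poissonH (i + 1) (x ^ 2)⁻¹ by simp [sphericalH, hx]]
  refine h'.congr' ?_
  filter_upwards [Ioi_mem_nhds hx] with x (hx : 0 < x)
  simp [sphericalH, hx]

lemma antitoneOn_binomCDF (n m : ℕ) : AntitoneOn (binomCDF n m) (Set.Icc 0 1) := by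
  refine antitoneOn_of_hasDerivWithinAt_nonpos (convex_Icc 0 1)
    (continuous_binomCDF n m).continuousOn
    (fun x _ ↦ (hasDerivAt_binomCDF n m x).hasDerivWithinAt) fun x hx ↦ ?_
  rw [interior_Icc] at hx
  have h0 := hx.1.le
  have h1 := sub_nonneg.2 hx.2.le
  exact neg_nonpos.2 (by positivity)

/-- Monotonicity is inherited from the finite products: each factor decreases in `q`, and `q`
decreases in `x`. -/
lemma monotone_sphericalH : Monotone sphericalH := by
  intro x y hxy
  rcases le_or_gt x 0 with hx | hx
  · simpa [sphericalH, hx.not_gt] using sphericalH_nonneg y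
  refine le_of_tendsto_of_tendsto' (tendsto_prod_binomCDF_sphericalH hx)
    (tendsto_prod_binomCDF_sphericalH (hx.trans_le hxy)) fun n ↦ ?_
  have hq (x : ℝ) : (1 + (x * √n) ^ 2)⁻¹ ∈ Set.Icc (0 : ℝ) 1 :=
    ⟨by positivity, inv_le_one_of_one_le₀ (by nlinarith [sq_nonneg (x * √n)])⟩
  refine Finset.prod_le_prod (fun m _ ↦ binomCDF_nonneg n m (hq x).1 (hq x).2) fun m _ ↦
    antitoneOn_binomCDF n m (hq y) (hq x) ?_
  gcongr

/-- The distribution function `H` as a Stieltjes function. -/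
noncomputable def sphericalStieltjes : StieltjesFunction ℝ where
  toFun := sphericalH
  mono' := monotone_sphericalH
  right_continuous' x := by
    rcases lt_trichotomy x 0 with hx | rfl | hx
    · refine ContinuousAt.continuousWithinAt (continuousAt_const (y := (0 : ℝ)) |>.congr ?_)
      filter_upwards [Iio_mem_nhds hx] with z (hz : z < 0)
      simp [sphericalH, hz.not_gt]
    · rw [← continuousWithinAt_Ioi_iff_Ici, ContinuousWithinAt]
      have h0 : sphericalH 0 = 0 := by simp [sphericalH]
      rw [h0]
      exact tendsto_sphericalH_nhdsGT_zero
    · exact (continuousAt_sphericalH hx).continuousWithinAt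

lemma tendsto_sphericalH_atBot : Tendsto sphericalH atBot (𝓝 0) := by
  refine tendsto_const_nhds.congr' ?_
  filter_upwards [eventually_le_atBot 0] with x hx
  simp [sphericalH, hx.not_gt]

instance : IsProbabilityMeasure sphericalStieltjes.measure :=
  sphericalStieltjes.isProbabilityMeasure tendsto_sphericalH_atBot tendsto_sphericalH_atTop

lemma cdf_sphericalStieltjes (x : ℝ) : cdf sphericalStieltjes.measure x = sphericalH x := by
  rw [cdf_measure_stieltjesFunction _ tendsto_sphericalH_atBot tendsto_sphericalH_atTop]
  rfl

/-! ### Integration of the joint density over polydiscs -/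

/-- The squared modulus of the Vandermonde determinant as a double sum over permutations. -/
lemma prod_norm_sub_sq_eq_sum {n : ℕ} (w : Fin n → ℂ) :
    ((∏ j : Fin n, ∏ k ∈ Finset.Ioi j, ‖w j - w k‖ ^ 2 : ℝ) : ℂ) =
      ∑ σ : Equiv.Perm (Fin n), ∑ τ : Equiv.Perm (Fin n),
        ((Equiv.Perm.sign σ : ℤ) : ℂ) * ((Equiv.Perm.sign τ : ℤ) : ℂ) *
          ∏ j, (w j ^ (σ j : ℕ) * conj (w j) ^ (τ j : ℕ)) := by
  have hdet : ((∏ j : Fin n, ∏ k ∈ Finset.Ioi j, ‖w j - w k‖ ^ 2 : ℝ) : ℂ) =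
      (Matrix.vandermonde w).transpose.det * conj (Matrix.vandermonde w).transpose.det := by
    rw [Matrix.det_transpose, Matrix.det_vandermonde, map_prod, ← Finset.prod_mul_distrib]
    push_cast
    refine Finset.prod_congr rfl fun j _ ↦ ?_
    rw [map_prod, ← Finset.prod_mul_distrib]
    refine Finset.prod_congr rfl fun k _ ↦ ?_
    rw [Complex.mul_conj, Complex.normSq_eq_norm_sq, norm_sub_rev]
    push_cast
    rfl
  rw [hdet, Matrix.det_apply', map_sum, Finset.sum_mul_sum]
  refine Finset.sum_congr rfl fun σ _ ↦ Finset.sum_congr rfl fun τ _ ↦ ?_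
  simp only [map_mul, map_prod, map_intCast, map_pow, Matrix.transpose_apply,
    Matrix.vandermonde_apply, Finset.prod_mul_distrib]
  ring

/-- The Andréief identity for a weight whose monomials are orthogonal. -/
lemma integral_prod_norm_sub_sq {n : ℕ} (μ : Measure ℂ) [SigmaFinite μ] (ρ : ℂ → ℝ)
    (hint : ∀ a b : ℕ, Integrable (fun w ↦ w ^ a * conj w ^ b * (ρ w : ℂ)) μ)
    (horth : ∀ a b : ℕ, a ≠ b → ∫ w, w ^ a * conj w ^ b * (ρ w : ℂ) ∂μ = 0) :
    ∫ w : Fin n → ℂ, (∏ j : Fin n, ∏ k ∈ Finset.Ioi j, ‖w j - w k‖ ^ 2) * ∏ k, ρ (w k)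
        ∂(Measure.pi fun _ ↦ μ) =
      n.factorial * ∏ k : Fin n, ∫ w, ‖w‖ ^ (2 * (k : ℕ)) * ρ w ∂μ := by
  have hdiag (a : ℕ) : ∫ w, w ^ a * conj w ^ a * (ρ w : ℂ) ∂μ =
      ((∫ w, ‖w‖ ^ (2 * a) * ρ w ∂μ : ℝ) : ℂ) := by
    rw [← integral_complex_ofReal]
    congr 1 with w
    rw [← mul_pow, Complex.mul_conj, Complex.normSq_eq_norm_sq, pow_mul]
    push_cast
    rfl
  -- Orthogonality kills the terms with `σ ≠ τ`; on the diagonal the signs cancel and reindexing by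
  -- `σ` makes all `n!` terms equal.
  have hterm (σ τ : Equiv.Perm (Fin n)) :
      ∫ w : Fin n → ℂ, ((Equiv.Perm.sign σ : ℤ) : ℂ) * ((Equiv.Perm.sign τ : ℤ) : ℂ) *
        ∏ j, (w j ^ (σ j : ℕ) * conj (w j) ^ (τ j : ℕ) * (ρ (w j) : ℂ)) ∂(Measure.pi fun _ ↦ μ) =
      if σ = τ then ((∏ k : Fin n, ∫ w, ‖w‖ ^ (2 * (k : ℕ)) * ρ w ∂μ : ℝ) : ℂ) else 0 := by
    rw [integral_const_mul, integral_fintype_prod_eq_prod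
      (f := fun j w ↦ w ^ (σ j : ℕ) * conj w ^ (τ j : ℕ) * (ρ w : ℂ))]
    split_ifs with h
    · subst h
      rw [← Int.cast_mul, ← Units.val_mul, Int.units_mul_self]
      simp only [hdiag]
      rw [Equiv.prod_comp σ fun k : Fin n ↦ ((∫ w, ‖w‖ ^ (2 * (k : ℕ)) * ρ w ∂μ : ℝ) : ℂ)]
      push_cast
      simp
    · obtain ⟨j, hj⟩ : ∃ j, σ j ≠ τ j := by
        by_contra! hc
        exact h (Equiv.ext hc)
      rw [Finset.prod_eq_zero (Finset.mem_univ j)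
        (horth _ _ fun hc ↦ hj (Fin.ext hc)), mul_zero]
  have hi (σ τ : Equiv.Perm (Fin n)) : Integrable (fun w : Fin n → ℂ ↦
      ((Equiv.Perm.sign σ : ℤ) : ℂ) * ((Equiv.Perm.sign τ : ℤ) : ℂ) *
        ∏ j, (w j ^ (σ j : ℕ) * conj (w j) ^ (τ j : ℕ) * (ρ (w j) : ℂ)))
      (Measure.pi fun _ ↦ μ) :=
    (Integrable.fintype_prod
      (f := fun (j : Fin n) w ↦ w ^ (σ j : ℕ) * conj w ^ (τ j : ℕ) * (ρ w : ℂ))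
      fun j ↦ hint _ _).const_mul _
  apply Complex.ofReal_injective
  rw [← integral_complex_ofReal]
  calc _ = ∫ w : Fin n → ℂ, ∑ σ : Equiv.Perm (Fin n), ∑ τ : Equiv.Perm (Fin n),
        ((Equiv.Perm.sign σ : ℤ) : ℂ) * ((Equiv.Perm.sign τ : ℤ) : ℂ) *
        ∏ j, (w j ^ (σ j : ℕ) * conj (w j) ^ (τ j : ℕ) * (ρ (w j) : ℂ))
          ∂(Measure.pi fun _ ↦ μ) := by
        congr 1 with w
        rw [Complex.ofReal_mul, prod_norm_sub_sq_eq_sum, Finset.sum_mul]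
        refine Finset.sum_congr rfl fun σ _ ↦ ?_
        rw [Finset.sum_mul]
        refine Finset.sum_congr rfl fun τ _ ↦ ?_
        rw [Finset.prod_mul_distrib (g := fun j ↦ (ρ (w j) : ℂ)), Complex.ofReal_prod]
        ring
    _ = _ := by
        rw [integral_finsetSum _ fun σ _ ↦ integrable_finsetSum _ fun τ _ ↦ hi σ τ]
        simp_rw [integral_finsetSum _ fun τ _ ↦ hi _ τ, hterm]
        simp [Fintype.card_perm]

/-- Rotation by the angle `π / (a - b)` preserves the disc and negates the integrand; conjugation
reduces to `b < a`. -/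
lemma setIntegral_closedBall_monomial_eq_zero (R : ℝ) (g : ℝ → ℝ) {a b : ℕ} (hab : a ≠ b) :
    ∫ w in Metric.closedBall (0 : ℂ) R, w ^ a * conj w ^ b * (g ‖w‖ : ℂ) = 0 := by
  wlog h : b < a generalizing a b
  · have h' := this hab.symm (by omega)
    refine Eq.trans ?_ ((congrArg conj h').trans (map_zero _))
    rw [← integral_conj]
    congr 1 with w
    simp only [map_mul, map_pow, Complex.conj_conj, Complex.conj_ofReal]
    ring
  set u : Circle := Circle.exp (Real.pi / (a - b : ℕ)) with hu
  have hd : ((a - b : ℕ) : ℝ) ≠ 0 := by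
    have : a - b ≠ 0 := by omega
    exact_mod_cast this
  have hpow : (u : ℂ) ^ a * conj (u : ℂ) ^ b = -1 := by
    have h1 : (u : ℂ) ^ (a - b) = -1 := by
      rw [hu, Circle.coe_exp, ← Complex.exp_nat_mul, ← Complex.exp_pi_mul_I]
      congr 1
      have hd' : ((a - b : ℕ) : ℂ) ≠ 0 := by exact_mod_cast hd
      push_cast
      field_simp
    have h2 : (u : ℂ) * conj (u : ℂ) = 1 := by
      rw [Complex.mul_conj, Circle.normSq_coe, Complex.ofReal_one]
    calc (u : ℂ) ^ a * conj (u : ℂ) ^ b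
        = (u : ℂ) ^ (a - b + b) * conj (u : ℂ) ^ b := by rw [Nat.sub_add_cancel h.le]
      _ = (u : ℂ) ^ (a - b) * ((u : ℂ) * conj (u : ℂ)) ^ b := by ring
      _ = -1 := by rw [h1, h2]; simp
  have hmp := (rotation u).measurePreserving
  have hinv := hmp.setIntegral_preimage_emb (rotation u).toHomeomorph.measurableEmbedding
    (fun w : ℂ ↦ w ^ a * conj w ^ b * (g ‖w‖ : ℂ)) (Metric.closedBall 0 R)
  have hpre : rotation u ⁻¹' Metric.closedBall 0 R = Metric.closedBall 0 R := by
    ext w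
    rw [Set.mem_preimage, mem_closedBall_zero_iff, mem_closedBall_zero_iff,
      LinearIsometryEquiv.norm_map]
  rw [hpre] at hinv
  have hneg (w : ℂ) : (rotation u w) ^ a * conj (rotation u w) ^ b * (g ‖rotation u w‖ : ℂ) =
      -(w ^ a * conj w ^ b * (g ‖w‖ : ℂ)) := by
    rw [LinearIsometryEquiv.norm_map, rotation_apply, map_mul, mul_pow, mul_pow]
    calc _ = ((u : ℂ) ^ a * conj (u : ℂ) ^ b) * (w ^ a * conj w ^ b * (g ‖w‖ : ℂ)) := by ring
      _ = _ := by rw [hpow]; ring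
  simp_rw [hneg] at hinv
  rw [integral_neg] at hinv
  exact self_eq_neg.1 hinv.symm

/-- In polar coordinates the integrand is, up to a constant, the derivative of `binomCDF n m (1 + r
^ 2)⁻¹`, which vanishes at `r = 0` since `m < n`. -/
lemma setIntegral_closedBall_radial (k n m : ℕ) (hn : k + m + 1 = n) {R : ℝ} (hR : 0 ≤ R) :
    ∫ w in Metric.closedBall (0 : ℂ) R, ‖w‖ ^ (2 * k) * (1 / (1 + ‖w‖ ^ 2) ^ (n + 1)) =
      Real.pi / (n.choose m * (n - m : ℕ)) * binomCDF n m (1 + R ^ 2)⁻¹ := by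
  set f : ℝ → ℝ := fun r ↦ r ^ (2 * k) * (1 / (1 + r ^ 2) ^ (n + 1)) with hf
  set c : ℝ := n.choose m * (n - m : ℕ) with hc
  have hc0 : c ≠ 0 := by
    have h1 : n.choose m ≠ 0 := (Nat.choose_pos (by omega)).ne'
    have h2 : n - m ≠ 0 := by omega
    rw [hc]
    exact mul_ne_zero (by exact_mod_cast h1) (by exact_mod_cast h2)
  have h1 : ∫ w in Metric.closedBall (0 : ℂ) R, f ‖w‖ =
      ∫ w : ℂ, (Set.Iic R).indicator f ‖w‖ := by
    rw [← integral_indicator Metric.isClosed_closedBall.measurableSet]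
    congr 1 with w
    simp [Set.indicator]
  have h2 : ∫ r in Set.Ioi (0 : ℝ), r ^ (2 - 1) • (Set.Iic R).indicator f r =
      ∫ r in (0 : ℝ)..R, r * f r := by
    rw [intervalIntegral.integral_of_le hR, ← Set.Ioi_inter_Iic, Set.inter_comm,
      ← Measure.restrict_restrict measurableSet_Iic, ← integral_indicator measurableSet_Iic]
    congr 1 with r
    by_cases hr : r ≤ R <;> simp [Set.indicator, hr]
  have hderiv (r : ℝ) :
      HasDerivAt (fun r ↦ (2 * c)⁻¹ * binomCDF n m (1 + r ^ 2)⁻¹) (r * f r) r := by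
    have hr : (1 + r ^ 2 : ℝ) ≠ 0 := by positivity
    have hq : HasDerivAt (fun r : ℝ ↦ (1 + r ^ 2)⁻¹) (-(2 * r) / (1 + r ^ 2) ^ 2) r := by
      have := ((hasDerivAt_pow 2 r).const_add 1).fun_inv hr
      simpa using this
    refine (((hasDerivAt_binomCDF n m _).comp r hq).const_mul (2 * c)⁻¹).congr_deriv ?_
    have hk : n - m - 1 = k := by omega
    have hq1 : 1 - (1 + r ^ 2)⁻¹ = r ^ 2 * (1 + r ^ 2)⁻¹ := by field_simp; ring
    rw [hk, hq1, ← hc, hf, ← hn]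
    simp only [inv_pow, mul_pow]
    generalize 1 + r ^ 2 = s at hr ⊢
    field_simp
    ring
  have h3 : ∫ r in (0 : ℝ)..R, r * f r = (2 * c)⁻¹ * binomCDF n m (1 + R ^ 2)⁻¹ := by
    rw [intervalIntegral.integral_eq_sub_of_hasDerivAt fun r _ ↦ hderiv r]
    · simp [binomCDF_one (show m < n by omega)]
    · refine Continuous.intervalIntegrable ?_ _ _
      have (r : ℝ) : (1 + r ^ 2) ^ (n + 1) ≠ 0 := by positivity
      rw [hf]
      fun_prop (disch := assumption)
  rw [h1, integral_fun_norm_addHaar, Complex.finrank_real_complex, h2, h3, measureReal_def,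
    Complex.volume_ball]
  simp
  field_simp

lemma measure_forall_norm_le {Ω : Type*} [MeasurableSpace Ω] {P : Measure Ω} {n : ℕ}
    {z : Fin n → Ω → ℂ} (h : HasSphericalDensity P n z) :
    ∃ K : ℝ, ∀ R : ℝ, 0 ≤ R → P.real {ω | ∀ j, ‖z j ω‖ ≤ R} =
      K * ∏ m ∈ Finset.range n, binomCDF n m (1 + R ^ 2)⁻¹ := by
  obtain ⟨C, hC, hlaw⟩ := h
  refine ⟨C * (n.factorial * ∏ m ∈ Finset.range n, (Real.pi / (n.choose m * (n - m : ℕ)))),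
    fun R hR ↦ ?_⟩
  have hset : MeasurableSet {w : Fin n → ℂ | ∀ j, ‖w j‖ ≤ R} := by measurability
  have hpi : {w : Fin n → ℂ | ∀ j, ‖w j‖ ≤ R} =
      Set.univ.pi fun _ ↦ Metric.closedBall (0 : ℂ) R := by ext; simp
  have hnn (w : Fin n → ℂ) : 0 ≤ C * sphericalWeight n w := by
    unfold sphericalWeight; positivity
  have hcont : Continuous fun w : ℂ ↦ 1 / (1 + ‖w‖ ^ 2) ^ (n + 1) := by
    have (w : ℂ) : (1 + ‖w‖ ^ 2) ^ (n + 1) ≠ 0 := by positivity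
    fun_prop (disch := assumption)
  have hmeas : Continuous (sphericalWeight n) := by
    unfold sphericalWeight
    refine Continuous.mul (by fun_prop) (continuous_finsetProd _ fun k _ ↦ ?_)
    exact hcont.comp (continuous_apply k)
  rw [measureReal_def, hlaw.measure_eq (p := fun w ↦ ∀ j, ‖w j‖ ≤ R) hset,
    withDensity_apply _ hset,
    ← integral_eq_lintegral_of_nonneg_ae (Eventually.of_forall hnn)
      (by fun_prop), integral_const_mul, hpi, volume_pi, Measure.restrict_pi_pi, mul_assoc]
  congr 1
  simp only [sphericalWeight]
  -- The product is reflected because the monomial of degree `k` corresponds to the threshold `m = n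
  -- - 1 - k`.
  rw [integral_prod_norm_sub_sq _ (fun w ↦ 1 / (1 + ‖w‖ ^ 2) ^ (n + 1)), mul_assoc,
    ← Finset.prod_mul_distrib, ← Finset.prod_range_reflect, Finset.prod_range]
  · congr 1
    refine Finset.prod_congr rfl fun k _ ↦ ?_
    exact setIntegral_closedBall_radial k n (n - 1 - k) (by omega) hR
  · intro a b
    refine ContinuousOn.integrableOn_compact (isCompact_closedBall 0 R)
      (Continuous.continuousOn ?_)
    have := Complex.continuous_ofReal.comp hcont
    exact ((continuous_id.pow a).mul (Complex.continuous_conj.pow b)).mul this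
  · intro a b hab
    exact setIntegral_closedBall_monomial_eq_zero R (fun r ↦ 1 / (1 + r ^ 2) ^ (n + 1)) hab

/-! ### Weak convergence and conclusion -/

/-- Pointwise convergence of distribution functions implies weak convergence. -/
lemma tendsto_probabilityMeasure_of_tendsto_cdf {μ : ℕ → ProbabilityMeasure ℝ}
    {ν : ProbabilityMeasure ℝ}
    (h : ∀ x, Tendsto (fun n ↦ cdf (μ n : Measure ℝ) x) atTop (𝓝 (cdf (ν : Measure ℝ) x))) :
    Tendsto μ atTop (𝓝 ν) := by
  -- Half-open intervals form a π-system containing small neighbourhoods of every point, and their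
  -- masses are differences of distribution function values.
  refine (isPiSystem_Ioc (id : ℝ → ℝ) id).tendsto_probabilityMeasure_of_tendsto_of_mem ?_ ?_ ?_
  · rintro s ⟨a, b, -, rfl⟩
    exact measurableSet_Ioc
  · intro u hu x hx
    obtain ⟨ε, hε, hb⟩ := Metric.isOpen_iff.1 hu x hx
    refine ⟨Set.Ioc (x - ε / 2) (x + ε / 2), ⟨_, _, ?_, rfl⟩,
      Ioc_mem_nhds (by linarith) (by linarith), fun y hy ↦ hb ?_⟩
    · simp only [id]; linarith
    · rw [Metric.mem_ball, Real.dist_eq, abs_lt]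
      constructor <;> linarith [hy.1, hy.2]
  · rintro s ⟨a, b, hab, rfl⟩
    have hIoc (ρ : ProbabilityMeasure ℝ) : ((ρ (Set.Ioc a b) : NNReal) : ℝ) =
        cdf (ρ : Measure ℝ) b - cdf (ρ : Measure ℝ) a := by
      rw [cdf_eq_real, cdf_eq_real, ← measureReal_sdiff (Set.Iic_subset_Iic.2 (show a ≤ b from hab.le))
        measurableSet_Iic, Set.Iic_sdiff_Iic]
      rfl
    rw [← NNReal.tendsto_coe]
    simp only [id, hIoc]
    exact (h b).sub (h a)

lemma cdf_map_eq {Ω : Type*} [MeasurableSpace Ω] {P : Measure Ω} [IsProbabilityMeasure P]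
    {X : Ω → ℝ} (hX : AEMeasurable X P) (x : ℝ) : cdf (P.map X) x = P.real {ω | X ω ≤ x} := by
  have := Measure.isProbabilityMeasure_map hX
  rw [cdf_eq_real, map_measureReal_apply_of_aemeasurable hX measurableSet_Iic]
  rfl

lemma HasSphericalDensity.aemeasurable_iSup_norm {Ω : Type*} [MeasurableSpace Ω]
    {P : Measure Ω} {n : ℕ} {z : Fin n → Ω → ℂ} (h : HasSphericalDensity P n z) :
    AEMeasurable (fun ω ↦ ⨆ j, ‖z j ω‖) P := by
  obtain ⟨C, -, hlaw⟩ := h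
  exact AEMeasurable.iSup fun j ↦ ((measurable_pi_apply j).comp_aemeasurable hlaw.aemeasurable).norm

/-- The distribution function of the largest modulus of a spherical ensemble. -/
lemma HasSphericalDensity.cdf_iSup_norm {Ω : Type*} [MeasurableSpace Ω] {P : Measure Ω}
    [IsProbabilityMeasure P] {n : ℕ} {z : Fin n → Ω → ℂ} (h : HasSphericalDensity P n z)
    {R : ℝ} (hR : 0 ≤ R) :
    cdf (P.map fun ω ↦ ⨆ j, ‖z j ω‖) R =
      ∏ m ∈ Finset.range n, binomCDF n m (1 + R ^ 2)⁻¹ := by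
  obtain ⟨K, hK⟩ := measure_forall_norm_le h
  have hset {R : ℝ} (hR : 0 ≤ R) : {ω | ⨆ j, ‖z j ω‖ ≤ R} = {ω | ∀ j, ‖z j ω‖ ≤ R} := by
    ext ω
    exact ⟨fun h j ↦ (le_ciSup (f := fun j ↦ ‖z j ω‖) (Set.finite_range _).bddAbove j).trans h,
      fun h ↦ Real.iSup_le h hR⟩
  have hcdf {R : ℝ} (hR : 0 ≤ R) : cdf (P.map fun ω ↦ ⨆ j, ‖z j ω‖) R =
      K * ∏ m ∈ Finset.range n, binomCDF n m (1 + R ^ 2)⁻¹ := by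
    rw [cdf_map_eq h.aemeasurable_iSup_norm, hset hR, hK R hR]
  have hq : Tendsto (fun R : ℝ ↦ (1 + R ^ 2)⁻¹) atTop (𝓝 0) :=
    tendsto_inv_atTop_zero.comp
      (tendsto_atTop_add_const_left _ _ (tendsto_pow_atTop two_ne_zero))
  have h1 : Tendsto (fun R : ℝ ↦ K * ∏ m ∈ Finset.range n, binomCDF n m (1 + R ^ 2)⁻¹) atTop
      (𝓝 (K * ∏ m ∈ Finset.range n, binomCDF n m 0)) :=
    (tendsto_finsetProd _ fun m _ ↦ ((continuous_binomCDF n m).tendsto 0).comp hq).const_mul K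
  -- As `R → ∞` the distribution function and every binomial factor tend to `1`.
  have hK1 : K = 1 := by
    refine tendsto_nhds_unique ?_ (tendsto_cdf_atTop (P.map fun ω ↦ ⨆ j, ‖z j ω‖))
    simp only [binomCDF_zero, Finset.prod_const_one, mul_one] at h1
    refine h1.congr' ?_
    filter_upwards [eventually_ge_atTop 0] with R hR using (hcdf hR).symm
  rw [hcdf hR, hK1, one_mul]

theorem theorem1 {Ω : ℕ → Type*} [∀ n, MeasurableSpace (Ω n)]
    (P : ∀ n, Measure (Ω n)) [∀ n, IsProbabilityMeasure (P n)]
    (z : ∀ n, Fin n → Ω n → ℂ)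
    (hz : ∀ n, 1 ≤ n → HasSphericalDensity (P n) n (z n)) :
    (∀ x : ℝ, 0 < x → Multipliable (fun i : ℕ ↦ poissonH (i + 1) (x ^ 2)⁻¹)) ∧
    ∃ (ν : Measure ℝ) (_ : IsProbabilityMeasure ν),
      (∀ x : ℝ, cdf ν x = sphericalH x) ∧
      TendstoInDistribution (fun (n : ℕ) (ω : Ω n) ↦ (1 / √(n : ℝ)) * ⨆ j : Fin n, ‖z n j ω‖)
        atTop (id : ℝ → ℝ) P ν := by
  refine ⟨fun x hx ↦ multipliable_poissonH (by positivity),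
    sphericalStieltjes.measure, inferInstance, cdf_sphericalStieltjes, ?_⟩
  have hmeas (n : ℕ) : AEMeasurable
      (fun ω : Ω n ↦ (1 / √(n : ℝ)) * ⨆ j : Fin n, ‖z n j ω‖) (P n) := by
    -- For `n = 0` no density is assumed, but the supremum over an empty index is constant.
    rcases Nat.eq_zero_or_pos n with rfl | hn
    · simp
    · exact (hz n hn).aemeasurable_iSup_norm.const_mul _
  refine ⟨hmeas, aemeasurable_id, tendsto_probabilityMeasure_of_tendsto_cdf fun x ↦ ?_⟩
  simp only [ProbabilityMeasure.coe_mk, Measure.map_id, cdf_sphericalStieltjes]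
  have hscale (n : ℕ) (hn : 1 ≤ n) :
      cdf ((P n).map fun ω ↦ (1 / √(n : ℝ)) * ⨆ j : Fin n, ‖z n j ω‖) x =
        cdf ((P n).map fun ω ↦ ⨆ j : Fin n, ‖z n j ω‖) (x * √n) := by
    have hs : 0 < √(n : ℝ) := Real.sqrt_pos.2 (by exact_mod_cast hn)
    rw [cdf_map_eq (hmeas n), cdf_map_eq (hz n hn).aemeasurable_iSup_norm]
    congr 1 with ω
    rw [Set.mem_ofPred_eq, Set.mem_ofPred_eq, one_div, inv_mul_le_iff₀ hs, mul_comm]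
  rcases le_or_gt x 0 with hx | hx
  · have h0 : sphericalH x = 0 := by simp [sphericalH, hx.not_gt]
    rw [h0]
    refine tendsto_const_nhds.congr' ?_
    filter_upwards [eventually_ge_atTop 1] with n hn
    rw [hscale n hn]
    refine le_antisymm (cdf_nonneg _ _) ?_
    have hle : x * √n ≤ 0 := mul_nonpos_of_nonpos_of_nonneg hx (Real.sqrt_nonneg _)
    refine (monotone_cdf _ hle).trans_eq ?_
    rw [(hz n hn).cdf_iSup_norm le_rfl]
    -- At `R = 0` one has `q = 1`, and the factor `m = 0` already vanishes.
    exact Finset.prod_eq_zero (Finset.mem_range.2 hn) (by simp [binomCDF_one hn])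
  · refine (tendsto_prod_binomCDF_sphericalH hx).congr' ?_
    filter_upwards [eventually_ge_atTop 1] with n hn
    rw [hscale n hn, (hz n hn).cdf_iSup_norm (by positivity)]
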